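/- Let $n\ge 0$ and $k\ge 2$ be integers. For $0<\rho<1$ let $\epsilon=(1-\sqrt\rho)/2$ and let $Y^1,\dots,Y^k\in\{0,1\}^n$ be $\rho$-correlated uniform binary strings: $Y^i=X+Z^i$ (addition mod $2$), where $X$ is uniform on $\{0,1\}^n$, all coordinates of $Z^1,\dots,Z^k$ are Bernoulli($\epsilon$), and $X$ and all these coordinates are independent. For $f:\{0,1\}^n\to\{0,1\}$ write $A_\rho(f)=\mathbb P(f(Y^1)=\cdots=f(Y^k))$, and let $W_1(f)=\sum_{i=1}^n\hat f(\{i\})^2$ be its degree-1 Fourier weight, where $\hat f(\{i\})=\mathbb E\, f(x)(-1)^{x_i}$ for $x$ uniform on $\{0,1\}^n$. Call $f$ lexicographic if its support is an initial or a final segment of $\{0,1\}^n$ in the lexicographic order. For $m\in\mathbb R$ let $\mathcal F_m$ be the set of all $f:\{0,1\}^n\to\{0,1\}$ with $\mathbb E f=m$. (1) There is $\rho_0\in(0,1)$, depending only on $n$ and $k$, such that for every $m$ with $\mathcal F_m\ne\emptyset$: some $f\in\mathcal F_m$ with maximal degree-1 Fourier weight in $\mathcal F_m$ maximizes $A_\rho$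 over $\mathcal F_m$ for all $0<\rho<\rho_0$ simultaneously; for every $0<\rho<\rho_0$, every maximizer of $A_\rho$ over $\mathcal F_m$ has maximal degree-1 Fourier weight in $\mathcal F_m$; and, for every $0<\rho<\rho_0$ and $f,g\in\mathcal F_m$, $W_1(g)<W_1(f)$ implies $A_\rho(g)<A_\rho(f)$. (2) There is $\rho_1\in(0,1)$, depending only on $n$ and $k$, such that for every $m$ with $\mathcal F_m\ne\emptyset$: $\mathcal F_m$ contains a lexicographic function, and for every $\rho_1<\rho<1$ every lexicographic function in $\mathcal F_m$ maximizes $A_\rho$ over $\mathcal F_m$. -/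

import Mathlib

open MeasureTheory

/-- The discrete cube `{0,1}^n`; addition is coordinatewise modulo 2. -/
abbrev Cube (n : ℕ) : Type := Fin n → Fin 2

/-- A Boolean function `{0,1}^n → {0,1}`. -/
abbrev BoolFun (n : ℕ) : Type := Cube n → Fin 2

/-- The real number `0` or `1` given by a bit. -/
def bitToReal (b : Fin 2) : ℝ := ((b : ℕ) : ℝ)

/-- The mean `𝔼 f` with respect to the uniform measure on the cube. -/
noncomputable def boolMean {n : ℕ} (f : BoolFun n) : ℝ :=
  (∑ x : Cube n, bitToReal (f x)) / 2 ^ n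

/-- The Boolean functions on `{0,1}^n` with mean `m`. -/
def boolFunWithMean (n : ℕ) (m : ℝ) : Set (BoolFun n) :=
  {f | boolMean f = m}

/-- The Walsh function `W_A(x) = (-1)^{∑_{i ∈ A} x_i}`. -/
def walsh {n : ℕ} (A : Finset (Fin n)) (x : Cube n) : ℝ :=
  (-1) ^ (∑ i ∈ A, (x i : ℕ))

/-- The Fourier coefficient `𝔼 (f W_A)`. -/
noncomputable def fourierCoeff01 {n : ℕ} (f : BoolFun n) (A : Finset (Fin n)) : ℝ :=
  (∑ x : Cube n, bitToReal (f x) * walsh A x) / 2 ^ n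

/-- The degree-1 Fourier weight. -/
noncomputable def degreeOneWeight {n : ℕ} (f : BoolFun n) : ℝ :=
  ∑ i : Fin n, fourierCoeff01 f {i} ^ 2

/-- The Bernoulli(`ε`) law of one bit (used for `0 ≤ ε ≤ 1`). -/
noncomputable def bernoulliBit (ε : ℝ) : Measure (Fin 2) :=
  ENNReal.ofReal (1 - ε) • Measure.dirac 0 + ENNReal.ofReal ε • Measure.dirac 1

/-- The noise law on `{0,1}^n`: independent Bernoulli(`ε`) coordinates. -/
noncomputable def cubeNoise (n : ℕ) (ε : ℝ) : Measure (Cube n) :=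
  Measure.pi fun _ : Fin n => bernoulliBit ε

/-- The uniform probability measure on `{0,1}^n`. -/
noncomputable def cubeUniform (n : ℕ) : Measure (Cube n) :=
  ProbabilityTheory.uniformOn Set.univ

/-- The joint law of `k` `ρ`-correlated uniform binary strings of length `n`, that is, of
`(X + Z^1, …, X + Z^k)` where `X` is uniform on `{0,1}^n`, all coordinates of all the `Z^i` are
Bernoulli(`ε`) with `(1 - 2ε)^2 = ρ`, `ε ≤ 1/2`, and everything is independent. -/
noncomputable def correlatedLaw (n k : ℕ) (ρ : ℝ) : Measure (Fin k → Cube n) :=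
  ((cubeUniform n).prod
      (Measure.pi fun _ : Fin k => cubeNoise n ((1 - Real.sqrt ρ) / 2))).map
    fun ω i => ω.1 + ω.2 i

/-- The agreement probability `ℙ(f(Y^1) = ⋯ = f(Y^k))` for `ρ`-correlated uniform `Y^1, …, Y^k`. -/
noncomputable def agreementProb {n : ℕ} (k : ℕ) (ρ : ℝ) (f : BoolFun n) : ℝ :=
  (correlatedLaw n k ρ).real {y | ∀ i j : Fin k, f (y i) = f (y j)}

/-- `f` is lexicographic: its support consists of the first elements of `{0,1}^n` in the
lexicographic order (first coordinate most significant), the alphabet being ordered either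
as `0 < 1` (initial segment) or as `1 < 0` (final segment for `0 < 1`). -/
def IsLexicographic {n : ℕ} (f : BoolFun n) : Prop :=
  IsLowerSet {x : Lex (Cube n) | f (ofLex x) = 1} ∨
    IsUpperSet {x : Lex (Cube n) | f (ofLex x) = 1}

/-! Conditionally on X = x, the Y^i are independent and each f(Y^i) equals 1 with probability p =
Tf(x), T being the noise operator. So A is the mean over x of p^k + (1 - p)^k, a polynomial in the
noise rate ε.

Near ρ = 0, put δ = √ρ = 1 - 2ε. Then Tf = m + δ f₁ + o(δ), with f₁ the degree-one part of f. T
preserves the mean, so the linear term averages out, and A is a constant depending on m and k plus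
C(k,2)(m^(k-2) + (1-m)^(k-2)) W₁(f) δ² + o(δ²) (`tendsto_agreement_sub_div`). A strict inequality of
weights therefore decides. Ties are settled by polynomiality in δ: a difference of two agreements
keeps a weak sign near 0+, so finitely many functions have one simultaneous maximizer.

Near ρ = 1, A is 1 at ε = 0 and its derivative there rewards pairs of adjacent support points
(`hasDerivAt_agreement_zero`). The number of such pairs is at most twice the digit sum of 0, …, N-1,
with N the support size (`adjacentPairs_le`), and lexicographic segments attain this. First order
cannot separate two optimal sets of equal size, but they are isometric
(`EdgeOptimal.cubeEquivalent`), and A is invariant under isometries.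

There are finitely many pairs of functions on the cube, so one threshold serves every m. -/

/-! ### Binary digit sums -/

/-- The number of ones in the binary expansions of `0, …, N - 1`. -/
def digitSumBelow (N : ℕ) : ℕ := ∑ j ∈ Finset.range N, (Nat.digits 2 j).sum

theorem digits_two_sum_double (j : ℕ) :
    (Nat.digits 2 (2 * j)).sum = (Nat.digits 2 j).sum := by
  rcases Nat.eq_zero_or_pos j with rfl | hj
  · simp
  · rw [Nat.digits_def' (by norm_num) (by omega)]
    simp

theorem digits_two_sum_double_add_one (j : ℕ) :
    (Nat.digits 2 (2 * j + 1)).sum = (Nat.digits 2 j).sum + 1 := by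
  rw [Nat.digits_def' (by norm_num) (by omega)]
  have h1 : (2 * j + 1) % 2 = 1 := by omega
  have h2 : (2 * j + 1) / 2 = j := by omega
  rw [h1, h2, List.sum_cons, add_comm]

theorem digitSumBelow_succ (N : ℕ) :
    digitSumBelow (N + 1) = digitSumBelow N + (Nat.digits 2 N).sum :=
  Finset.sum_range_succ _ _

theorem digitSumBelow_double (N : ℕ) : digitSumBelow (2 * N) = 2 * digitSumBelow N + N := by
  induction N with
  | zero => simp [digitSumBelow]
  | succ N ih =>
    have : 2 * (N + 1) = 2 * N + 1 + 1 := by ring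
    rw [this, digitSumBelow_succ, digitSumBelow_succ, ih, digits_two_sum_double,
      digits_two_sum_double_add_one, digitSumBelow_succ]
    ring

theorem digitSumBelow_double_add_one (N : ℕ) :
    digitSumBelow (2 * N + 1) = digitSumBelow N + digitSumBelow (N + 1) + N := by
  rw [digitSumBelow_succ, digitSumBelow_double, digitSumBelow_succ, digits_two_sum_double]
  ring

theorem digitSumBelow_zero : digitSumBelow 0 = 0 := rfl

theorem digitSumBelow_one : digitSumBelow 1 = 0 := by simp [digitSumBelow]

/-- Arithmetic core of the edge-isoperimetric inequality: a and b are the sizes of the two halves of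
a set, and at most b edges join them. Halving both numbers by parity reduces the claim to smaller
sums. -/
theorem digitSumBelow_superadditive (a b : ℕ) (hab : b ≤ a) :
    digitSumBelow a + digitSumBelow b + b ≤ digitSumBelow (a + b) := by
  induction hN : a + b using Nat.strong_induction_on generalizing a b with
  | _ N ih =>
    subst hN
    rcases Nat.eq_zero_or_pos b with rfl | hb
    · simp [digitSumBelow_zero]
    obtain ⟨a, rfl | rfl⟩ := Nat.even_or_odd' a <;> obtain ⟨b, rfl | rfl⟩ := Nat.even_or_odd' b
    · have h := ih (a + b) (by omega) a b (by omega) rfl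
      rw [← mul_add, digitSumBelow_double, digitSumBelow_double, digitSumBelow_double]
      omega
    · have h1 := ih (a + b) (by omega) a b (by omega) rfl
      have h2 := ih (a + (b + 1)) (by omega) a (b + 1) (by omega) rfl
      have : 2 * a + (2 * b + 1) = 2 * (a + b) + 1 := by ring
      rw [this, digitSumBelow_double, digitSumBelow_double_add_one, digitSumBelow_double_add_one,
        add_assoc a b 1]
      omega
    · have h1 := ih (a + b) (by omega) a b (by omega) rfl
      have h2 := ih (a + 1 + b) (by omega) (a + 1) b (by omega) rfl
      have : 2 * a + 1 + 2 * b = 2 * (a + b) + 1 := by ring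
      rw [this, digitSumBelow_double, digitSumBelow_double_add_one, digitSumBelow_double_add_one,
        add_right_comm a b 1]
      omega
    · rcases Nat.eq_zero_or_pos (a + b) with h0 | h0
      · obtain ⟨rfl, rfl⟩ : a = 0 ∧ b = 0 := by omega
        have := digitSumBelow_double 1
        simp [digitSumBelow_one] at this ⊢
        omega
      have h1 := ih (a + 1 + b) (by omega) (a + 1) b (by omega) rfl
      -- The pair (a, b + 1) is ordered only if b < a; when a = b the bound is `h1` with the
      -- summands swapped.
      have h2 : digitSumBelow a + digitSumBelow (b + 1) + b ≤ digitSumBelow (a + 1 + b) := by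
        rcases hab.lt_or_eq with h | h
        · have := ih (a + (b + 1)) (by omega) a (b + 1) (by omega) rfl
          rw [show a + 1 + b = a + (b + 1) by ring]
          omega
        · obtain rfl : a = b := by omega
          omega
      have : 2 * a + 1 + (2 * b + 1) = 2 * (a + 1 + b) := by ring
      rw [this, digitSumBelow_double, digitSumBelow_double_add_one, digitSumBelow_double_add_one]
      omega

/-- Each j < c ≤ 2^r gains exactly one binary digit 1 on adding 2^r. -/
theorem digitSumBelow_two_pow_add (r c : ℕ) (hc : c ≤ 2 ^ r) :
    digitSumBelow (2 ^ r + c) = digitSumBelow (2 ^ r) + digitSumBelow c + c := by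
  induction r generalizing c with
  | zero =>
    have h2 := digitSumBelow_double 1
    simp only [pow_zero] at hc ⊢
    interval_cases c <;> simp_all [digitSumBelow_zero, digitSumBelow_one]
  | succ r ih =>
    rw [pow_succ'] at hc ⊢
    obtain ⟨c, rfl | rfl⟩ := Nat.even_or_odd' c
    · rw [← mul_add, digitSumBelow_double, digitSumBelow_double, digitSumBelow_double,
        ih c (by omega)]
      ring
    · rw [← add_assoc, ← mul_add, digitSumBelow_double_add_one, digitSumBelow_double,
        digitSumBelow_double_add_one, ih c (by omega), add_assoc (2 ^ r) c 1, ih (c + 1) (by omega)]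
      ring

theorem two_mul_digitSumBelow_two_pow (n : ℕ) : 2 * digitSumBelow (2 ^ n) = n * 2 ^ n := by
  induction n with
  | zero => simp [digitSumBelow_one]
  | succ n ih =>
    rw [pow_succ', digitSumBelow_double, mul_add, ← mul_assoc, mul_comm 2 2, mul_assoc, ih]
    ring

/-- Flipping all n bits, j ↦ 2^n - 1 - j, carries the first a numbers to the last a and turns digit
sum s into n - s. -/
theorem digitSumBelow_compl (n a b : ℕ) (hab : a + b = 2 ^ n) :
    digitSumBelow b + n * a = digitSumBelow (2 ^ n) + digitSumBelow a := by
  induction n generalizing a b with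
  | zero =>
    simp only [pow_zero] at hab
    have : a ≤ 1 := by omega
    interval_cases a
    · obtain rfl : b = 1 := by omega
      simp [digitSumBelow_zero, digitSumBelow_one]
    · obtain rfl : b = 0 := by omega
      simp [digitSumBelow_zero, digitSumBelow_one]
  | succ n ih =>
    rw [pow_succ'] at hab ⊢
    obtain ⟨a, rfl | rfl⟩ := Nat.even_or_odd' a
    · obtain ⟨b, rfl⟩ : ∃ c, b = 2 * c := ⟨2 ^ n - a, by omega⟩
      have h := ih a b (by omega)
      rw [digitSumBelow_double, digitSumBelow_double, digitSumBelow_double]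
      have : a + b = 2 ^ n := by omega
      linarith
    · obtain ⟨b, rfl⟩ : ∃ c, b = 2 * c + 1 := ⟨2 ^ n - a - 1, by omega⟩
      have h1 := ih a (b + 1) (by omega)
      have h2 := ih (a + 1) b (by omega)
      rw [digitSumBelow_double, digitSumBelow_double_add_one, digitSumBelow_double_add_one]
      have : a + b + 1 = 2 ^ n := by omega
      linarith

/-- Equality in `digitSumBelow_superadditive` constrains the size of the larger summand. -/
theorem le_two_pow_of_digitSumBelow_add_eq (r a b : ℕ) (hb : 0 < b) (hab : a + b ≤ 2 ^ (r + 1))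
    (h : digitSumBelow (a + b) ≤ digitSumBelow a + digitSumBelow b + b) : a ≤ 2 ^ r := by
  by_contra! hlt
  obtain ⟨c, rfl⟩ := Nat.exists_eq_add_of_lt hlt
  rw [pow_succ'] at hab
  -- Removing 2^r from both a and a + b leaves S(c+1+b) ≤ S(c+1) + S(b), where S is `digitSumBelow`.
  -- Superadditivity contradicts this, as both summands are positive.
  rw [add_assoc (2 ^ r), add_assoc (2 ^ r), digitSumBelow_two_pow_add _ _ (by omega),
    digitSumBelow_two_pow_add _ _ (by omega)] at h
  rcases le_total b (c + 1) with h1 | h1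
  · have := digitSumBelow_superadditive (c + 1) b h1
    omega
  · have := digitSumBelow_superadditive b (c + 1) h1
    rw [add_comm b] at this
    omega

/-! ### Edge-isoperimetric inequality -/

/-- The size of the support. -/
def supportSize {n : ℕ} (f : BoolFun n) : ℕ := ∑ x, (f x : ℕ)

/-- The number of ordered pairs of adjacent vertices in the support. -/
def adjacentPairs {n : ℕ} (f : BoolFun n) : ℕ :=
  ∑ x, ∑ y, if hammingDist x y = 1 then (f x : ℕ) * (f y : ℕ) else 0

/-- The restriction to the face `x i = s`. -/
def restrictFace {n : ℕ} (i : Fin (n + 1)) (s : Fin 2) (f : BoolFun (n + 1)) : BoolFun n :=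
  fun x => f (Fin.insertNth (α := fun _ => Fin 2) i s x)

/-- The Boolean function of the complementary support. -/
def boolCompl {n : ℕ} (f : BoolFun n) : BoolFun n := fun x => f x + 1

/-- Equality in the edge-isoperimetric inequality. -/
def EdgeOptimal {n : ℕ} (f : BoolFun n) : Prop :=
  adjacentPairs f = 2 * digitSumBelow (supportSize f)

/-- Equivalence of Boolean functions under isometries of the cube. -/
def CubeEquivalent {n : ℕ} (f g : BoolFun n) : Prop :=
  ∃ e : Cube n ≃ Cube n, (∀ x y, hammingDist (e x) (e y) = hammingDist x y) ∧
    ∀ x, g (e x) = f x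

theorem hammingDist_insertNth {n : ℕ} (i : Fin (n + 1)) (a b : Fin 2) (x y : Cube n) :
    hammingDist (Fin.insertNth (α := fun _ => Fin 2) i a x)
      (Fin.insertNth (α := fun _ => Fin 2) i b y) =
      (if a = b then 0 else 1) + hammingDist x y := by
  simp only [hammingDist, Finset.card_filter]
  rw [Fin.sum_univ_succAbove _ i]
  simp

theorem sum_cube_succ {n : ℕ} {M : Type*} [AddCommMonoid M] (i : Fin (n + 1)) (s : Fin 2)
    (F : Cube (n + 1) → M) :
    ∑ x, F x = ∑ x : Cube n, F (Fin.insertNth (α := fun _ => Fin 2) i s x) +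
      ∑ x : Cube n, F (Fin.insertNth (α := fun _ => Fin 2) i (s + 1) x) := by
  rw [← (Fin.insertNthEquiv (fun _ => Fin 2) i).sum_comp, Fintype.sum_prod_type, Fin.sum_univ_two]
  fin_cases s
  · rfl
  · exact add_comm _ _

theorem supportSize_eq_restrictFace {n : ℕ} (i : Fin (n + 1)) (s : Fin 2) (f : BoolFun (n + 1)) :
    supportSize f = supportSize (restrictFace i s f) + supportSize (restrictFace i (s + 1) f) :=
  sum_cube_succ i s _

theorem fin_two_ne_add_one (s : Fin 2) : s ≠ s + 1 := by
  fin_cases s <;> decide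

theorem adjacentPairs_eq_restrictFace {n : ℕ} (i : Fin (n + 1)) (s : Fin 2)
    (f : BoolFun (n + 1)) :
    adjacentPairs f = adjacentPairs (restrictFace i s f) +
      adjacentPairs (restrictFace i (s + 1) f) +
      2 * ∑ x, (restrictFace i s f x : ℕ) * (restrictFace i (s + 1) f x : ℕ) := by
  have h1 (x y : Cube n) : (1 + hammingDist x y = 1) ↔ x = y := by
    rw [← hammingDist_eq_zero (x := x)]; omega
  unfold adjacentPairs
  rw [sum_cube_succ i s]
  simp only [sum_cube_succ i s (fun y => ite _ _ _), hammingDist_insertNth, if_true,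
    if_neg (fin_two_ne_add_one s), if_neg (fin_two_ne_add_one s).symm, h1, zero_add,
    Finset.sum_add_distrib, Finset.sum_ite_eq, Finset.mem_univ]
  simp only [restrictFace, mul_comm (f (Fin.insertNth (α := fun _ => Fin 2) i (s + 1) _) : ℕ)
    (f (Fin.insertNth (α := fun _ => Fin 2) i s _) : ℕ)]
  ring

theorem sum_mul_le_supportSize_right {n : ℕ} (f g : BoolFun n) :
    ∑ x, (f x : ℕ) * (g x : ℕ) ≤ supportSize g :=
  Finset.sum_le_sum fun x _ => by nlinarith [(f x).is_lt]

theorem sum_mul_le_supportSize_left {n : ℕ} (f g : BoolFun n) :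
    ∑ x, (f x : ℕ) * (g x : ℕ) ≤ supportSize f :=
  Finset.sum_le_sum fun x _ => by nlinarith [(g x).is_lt]

theorem sum_mul_eq_of_eq {n : ℕ} (f g : BoolFun n)
    (h : supportSize g ≤ ∑ x, (f x : ℕ) * (g x : ℕ)) (x : Cube n) (hx : f x = 0) : g x = 0 := by
  have h0 : ∀ x ∈ Finset.univ, (f x : ℕ) * (g x : ℕ) ≤ g x := fun x _ => by
    nlinarith [(f x).is_lt]
  have := (Finset.sum_eq_sum_iff_of_le h0).1
    (le_antisymm (sum_mul_le_supportSize_right f g) h) x (Finset.mem_univ _)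
  rw [hx] at this
  exact Fin.ext (by simpa using this.symm)

theorem supportSize_eq_zero {n : ℕ} {f : BoolFun n} : supportSize f = 0 ↔ ∀ x, f x = 0 := by
  simp [supportSize, Fin.val_eq_zero_iff]

theorem adjacentPairs_cube_zero (f : BoolFun 0) : adjacentPairs f = 0 := by
  refine Finset.sum_eq_zero fun x _ => Finset.sum_eq_zero fun y _ => ?_
  rw [Subsingleton.elim x y, hammingDist_self, if_neg zero_ne_one]

theorem supportSize_cube_zero (f : BoolFun 0) : supportSize f ≤ 1 := by
  simp [supportSize]
  omega

/-- The edge-isoperimetric inequality in the cube. -/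
theorem adjacentPairs_le {n : ℕ} (f : BoolFun n) :
    adjacentPairs f ≤ 2 * digitSumBelow (supportSize f) := by
  induction n with
  | zero => simp [adjacentPairs_cube_zero]
  | succ n ih =>
    rw [adjacentPairs_eq_restrictFace 0 0, supportSize_eq_restrictFace 0 0]
    have h0 := ih (restrictFace 0 0 f)
    have h1 := ih (restrictFace 0 (0 + 1) f)
    have h2 := sum_mul_le_supportSize_left (restrictFace 0 0 f) (restrictFace 0 (0 + 1) f)
    have h3 := sum_mul_le_supportSize_right (restrictFace 0 0 f) (restrictFace 0 (0 + 1) f)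
    rcases le_total (supportSize (restrictFace 0 0 f)) (supportSize (restrictFace 0 (0 + 1) f))
      with h | h
    · have := digitSumBelow_superadditive _ _ h
      rw [add_comm (supportSize _)] at this
      omega
    · have := digitSumBelow_superadditive _ _ h
      omega

/-! ### Equality cases and uniqueness up to isometry -/

/-- Equality in the sum of the bounds used in the induction forces equality in each. Equality in the
count of crossing edges puts the smaller half inside the translate of the larger. -/
theorem EdgeOptimal.restrictFace {n : ℕ} {f : BoolFun (n + 1)} (hf : EdgeOptimal f)
    (i : Fin (n + 1)) (s : Fin 2)
    (hs : supportSize (restrictFace i (s + 1) f) ≤ supportSize (restrictFace i s f)) :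
    EdgeOptimal (restrictFace i s f) ∧
      (∀ x, restrictFace i s f x = 0 → restrictFace i (s + 1) f x = 0) ∧
      digitSumBelow (supportSize (_root_.restrictFace i s f) +
          supportSize (_root_.restrictFace i (s + 1) f)) ≤
        digitSumBelow (supportSize (_root_.restrictFace i s f)) +
          digitSumBelow (supportSize (_root_.restrictFace i (s + 1) f)) +
          supportSize (_root_.restrictFace i (s + 1) f) := by
  unfold EdgeOptimal at hf ⊢
  rw [adjacentPairs_eq_restrictFace i s, supportSize_eq_restrictFace i s] at hf
  have h0 := adjacentPairs_le (_root_.restrictFace i s f)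
  have h1 := adjacentPairs_le (_root_.restrictFace i (s + 1) f)
  have h3 := sum_mul_le_supportSize_right (_root_.restrictFace i s f)
    (_root_.restrictFace i (s + 1) f)
  have h4 := digitSumBelow_superadditive _ _ hs
  exact ⟨by omega, sum_mul_eq_of_eq _ _ (by omega), by omega⟩

theorem exists_face_majority {n : ℕ} (f : BoolFun (n + 1)) (i : Fin (n + 1)) :
    ∃ s, supportSize (restrictFace i (s + 1) f) ≤ supportSize (restrictFace i s f) := by
  rcases le_total (supportSize (restrictFace i 1 f)) (supportSize (restrictFace i 0 f)) with h | h
  · exact ⟨0, h⟩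
  · exact ⟨1, h⟩

theorem insertNth_zero_insertNth {n : ℕ} (j : Fin (n + 1)) (t s : Fin 2) (x : Cube n) :
    Fin.insertNth (α := fun _ => Fin 2) j.succ t (Fin.insertNth (α := fun _ => Fin 2) 0 s x) =
      Fin.insertNth (α := fun _ => Fin 2) 0 s (Fin.insertNth (α := fun _ => Fin 2) j t x) := by
  simp only [Fin.insertNth_zero']
  exact Fin.insertNth_succ_cons j t s x

/-- An optimal set of at most half the size of the cube misses a face. -/
theorem EdgeOptimal.exists_empty_face {n : ℕ} {f : BoolFun (n + 1)} (hf : EdgeOptimal f)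
    (hsize : supportSize f ≤ 2 ^ n) : ∃ i s, supportSize (_root_.restrictFace i (s + 1) f) = 0 := by
  induction n with
  | zero =>
    obtain ⟨s, hs⟩ := exists_face_majority f 0
    refine ⟨0, s, ?_⟩
    rw [supportSize_eq_restrictFace 0 s, pow_zero] at hsize
    omega
  | succ n ih =>
    obtain ⟨s, hs⟩ := exists_face_majority f 0
    obtain ⟨h1, h2, h3⟩ := hf.restrictFace 0 s hs
    rcases Nat.eq_zero_or_pos (supportSize (_root_.restrictFace 0 (s + 1) f)) with h0 | h0
    · exact ⟨0, s, h0⟩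
    -- Both halves are nonempty, so the equality case bounds the larger by 2^n and induction gives
    -- it an empty face. The smaller half is contained in it, hence misses the same face.
    rw [supportSize_eq_restrictFace 0 s] at hsize
    obtain ⟨j, t, hjt⟩ := ih h1 (le_two_pow_of_digitSumBelow_add_eq n _ _ h0 hsize h3)
    refine ⟨j.succ, t, ?_⟩
    rw [supportSize_eq_zero] at hjt
    have key (x : Cube n) := insertNth_zero_insertNth j (t + 1) s x
    have key' (x : Cube n) := insertNth_zero_insertNth j (t + 1) (s + 1) x
    rw [supportSize_eq_restrictFace 0 s, Nat.add_eq_zero_iff, supportSize_eq_zero,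
      supportSize_eq_zero]
    refine ⟨fun x => ?_, fun x => ?_⟩
    · have := hjt x
      unfold _root_.restrictFace at this ⊢
      rwa [key]
    · have := h2 _ (hjt x)
      unfold _root_.restrictFace at this ⊢
      rwa [key']

theorem fin_two_add_one_add_one (s : Fin 2) : s + 1 + 1 = s := by
  fin_cases s <;> rfl

theorem fin_two_eq_or_eq_add_one : ∀ a s : Fin 2, a = s ∨ a = s + 1 := by
  decide

theorem val_add_one_add_val (s : Fin 2) : ((s + 1 : Fin 2) : ℕ) + (s : ℕ) = 1 := by
  fin_cases s <;> rfl

theorem boolCompl_boolCompl {n : ℕ} (f : BoolFun n) : boolCompl (boolCompl f) = f :=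
  funext fun x => fin_two_add_one_add_one (f x)

theorem supportSize_boolCompl {n : ℕ} (f : BoolFun n) :
    supportSize (boolCompl f) + supportSize f = 2 ^ n := by
  simp [supportSize, boolCompl, ← Finset.sum_add_distrib, val_add_one_add_val]

/-- A set and its complement have the same edge boundary, and the cube is n-regular. -/
theorem adjacentPairs_boolCompl {n : ℕ} (f : BoolFun n) :
    adjacentPairs (boolCompl f) + 2 * n * supportSize f = n * 2 ^ n + adjacentPairs f := by
  induction n with
  | zero => simp [adjacentPairs_cube_zero]
  | succ n ih =>
    rw [adjacentPairs_eq_restrictFace 0 0 f, adjacentPairs_eq_restrictFace 0 0 (boolCompl f),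
      supportSize_eq_restrictFace 0 0 f]
    have h0 := ih (restrictFace 0 0 f)
    have h1 := ih (restrictFace 0 (0 + 1) f)
    have h2 : (∑ x, (restrictFace 0 0 (boolCompl f) x : ℕ) *
        (restrictFace 0 (0 + 1) (boolCompl f) x : ℕ)) +
          (supportSize (restrictFace 0 0 f) + supportSize (restrictFace 0 (0 + 1) f)) =
        2 ^ n + ∑ x, (restrictFace 0 0 f x : ℕ) * (restrictFace 0 (0 + 1) f x : ℕ) := by
      have : 2 ^ n = ∑ x : Cube n, 1 := by simp
      rw [this]
      unfold supportSize
      simp only [← Finset.sum_add_distrib]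
      refine Finset.sum_congr rfl fun x _ => ?_
      change ((restrictFace 0 0 f x + 1 : Fin 2) : ℕ) *
        ((restrictFace 0 (0 + 1) f x + 1 : Fin 2) : ℕ) + _ = _
      generalize restrictFace 0 0 f x = a
      generalize restrictFace 0 (0 + 1) f x = b
      fin_cases a <;> fin_cases b <;> rfl
    have c0 : restrictFace 0 0 (boolCompl f) = boolCompl (restrictFace 0 0 f) := rfl
    have c1 : restrictFace 0 (0 + 1) (boolCompl f) = boolCompl (restrictFace 0 (0 + 1) f) := rfl
    rw [c0, c1] at h2 ⊢
    rw [pow_succ']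
    linarith

theorem EdgeOptimal.boolCompl {n : ℕ} {f : BoolFun n} (hf : EdgeOptimal f) :
    EdgeOptimal (boolCompl f) := by
  unfold EdgeOptimal at hf ⊢
  have h1 := adjacentPairs_boolCompl f
  have h2 := supportSize_boolCompl f
  have h3 := digitSumBelow_compl n (supportSize f) (supportSize (_root_.boolCompl f)) (by omega)
  have h4 := two_mul_digitSumBelow_two_pow n
  rw [hf] at h1
  linarith

theorem CubeEquivalent.boolCompl {n : ℕ} {f g : BoolFun n} (h : CubeEquivalent f g) :
    CubeEquivalent (boolCompl f) (boolCompl g) := by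
  obtain ⟨e, he, hfg⟩ := h
  exact ⟨e, he, fun x => congrArg (· + 1) (hfg x)⟩

theorem EdgeOptimal.restrictFace_of_empty {n : ℕ} {f : BoolFun (n + 1)} (hf : EdgeOptimal f)
    {i : Fin (n + 1)} {s : Fin 2} (hs : supportSize (_root_.restrictFace i (s + 1) f) = 0) :
    EdgeOptimal (_root_.restrictFace i s f) ∧
      supportSize (_root_.restrictFace i s f) = supportSize f :=
  ⟨(hf.restrictFace i s (by omega)).1, by rw [supportSize_eq_restrictFace i s f, hs, add_zero]⟩

/-- Functions supported on faces are equivalent if their restrictions to the faces are. -/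
theorem CubeEquivalent.of_restrictFace {n : ℕ} {f g : BoolFun (n + 1)} {i j : Fin (n + 1)}
    {s t : Fin 2} (hs : supportSize (restrictFace i (s + 1) f) = 0)
    (ht : supportSize (restrictFace j (t + 1) g) = 0)
    (h : CubeEquivalent (restrictFace i s f) (restrictFace j t g)) : CubeEquivalent f g := by
  obtain ⟨e, he, hfg⟩ := h
  rw [supportSize_eq_zero] at hs ht
  -- Shifting the distinguished coordinate by t - s takes the face carrying f to the face carrying
  -- g.
  let E := (Fin.insertNthEquiv (fun _ => Fin 2) i).symm.trans
    (((Equiv.addRight (t - s)).prodCongr e).trans (Fin.insertNthEquiv (fun _ => Fin 2) j))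
  have hE (a : Fin 2) (x : Cube n) : E (Fin.insertNth (α := fun _ => Fin 2) i a x) =
      Fin.insertNth (α := fun _ => Fin 2) j (a + (t - s)) (e x) := by
    simp [E, Fin.insertNthEquiv]
  have hi (x : Cube (n + 1)) :
      ∃ (a : Fin 2) (y : Cube n), Fin.insertNth (α := fun _ => Fin 2) i a y = x :=
    ⟨x i, i.removeNth x, by simp⟩
  refine ⟨E, fun x y => ?_, fun x => ?_⟩
  · obtain ⟨a, x, rfl⟩ := hi x
    obtain ⟨b, y, rfl⟩ := hi y
    simp only [hE, hammingDist_insertNth, he, add_left_inj]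
  · obtain ⟨a, x, rfl⟩ := hi x
    rw [hE]
    obtain rfl | rfl := fin_two_eq_or_eq_add_one a s
    · rw [add_sub_cancel]; exact hfg x
    · rw [add_right_comm, add_sub_cancel]
      exact (ht _).trans (hs x).symm

/-- Extremal sets of the edge-isoperimetric problem are unique up to isometry. -/
theorem EdgeOptimal.cubeEquivalent {n : ℕ} {f g : BoolFun n} (hf : EdgeOptimal f)
    (hg : EdgeOptimal g) (hfg : supportSize f = supportSize g) : CubeEquivalent f g := by
  induction n with
  | zero =>
    refine ⟨Equiv.refl _, fun _ _ => rfl, fun x => ?_⟩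
    simp only [supportSize, Fintype.sum_subsingleton _ x] at hfg
    exact Fin.ext hfg.symm
  | succ n ih =>
    have small {f g : BoolFun (n + 1)} (hf : EdgeOptimal f) (hg : EdgeOptimal g)
        (hfg : supportSize f = supportSize g) (hle : supportSize f ≤ 2 ^ n) :
        CubeEquivalent f g := by
      obtain ⟨i, s, hs⟩ := hf.exists_empty_face hle
      obtain ⟨j, t, ht⟩ := hg.exists_empty_face (hfg ▸ hle)
      obtain ⟨h1, h2⟩ := hf.restrictFace_of_empty hs
      obtain ⟨h3, h4⟩ := hg.restrictFace_of_empty ht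
      exact .of_restrictFace hs ht (ih h1 h3 (by omega))
    -- Sets above half the cube are handled through their complements, which are optimal too.
    rcases le_total (supportSize f) (2 ^ n) with h | h
    · exact small hf hg hfg h
    · have h1 := supportSize_boolCompl f
      have h2 := supportSize_boolCompl g
      have := (small hf.boolCompl hg.boolCompl (by omega)
        (by rw [pow_succ'] at h1; omega)).boolCompl
      rwa [boolCompl_boolCompl, boolCompl_boolCompl] at this

/-! ### Lexicographic segments are optimal -/

theorem toLex_insertNth_lt {n : ℕ} (x y : Cube n) (s t : Fin 2) :
    toLex (Fin.insertNth (α := fun _ => Fin 2) 0 s x : Cube (n + 1)) <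
      toLex (Fin.insertNth (α := fun _ => Fin 2) 0 t y : Cube (n + 1)) ↔
      s < t ∨ s = t ∧ toLex x < toLex y := by
  simp only [Fin.insertNth_zero']
  exact Fin.pi_lex_lt_cons_cons (s := fun {_} => (· < ·))

theorem isLowerSet_lex_iff {n : ℕ} (f : BoolFun n) :
    IsLowerSet {x : Lex (Cube n) | f (ofLex x) = 1} ↔
      ∀ x y : Cube n, toLex x < toLex y → f y = 1 → f x = 1 := by
  refine ⟨fun h x y hxy hy => h hxy.le hy, fun h y x hxy hy => ?_⟩
  rcases hxy.lt_or_eq with hlt | rfl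
  · exact h _ _ hlt hy
  · exact hy

theorem supportSize_eq_two_pow {n : ℕ} {f : BoolFun n} (h : ∀ x, f x = 1) :
    supportSize f = 2 ^ n := by
  simp [supportSize, h]

/-- Initial segments of the lexicographic order solve the edge-isoperimetric problem. -/
theorem edgeOptimal_of_isLowerSet {n : ℕ} {f : BoolFun n}
    (hf : IsLowerSet {x : Lex (Cube n) | f (ofLex x) = 1}) : EdgeOptimal f := by
  rw [isLowerSet_lex_iff] at hf
  induction n with
  | zero =>
    have := supportSize_cube_zero f
    unfold EdgeOptimal
    rw [adjacentPairs_cube_zero]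
    interval_cases supportSize f <;> rfl
  | succ n ih =>
    have h0 : EdgeOptimal (restrictFace 0 0 f) := ih fun x y hxy hy =>
      hf _ _ ((toLex_insertNth_lt x y 0 0).2 (Or.inr ⟨rfl, hxy⟩)) hy
    have h1 : EdgeOptimal (restrictFace 0 (0 + 1) f) := ih fun x y hxy hy =>
      hf _ _ ((toLex_insertNth_lt x y 1 1).2 (Or.inr ⟨rfl, hxy⟩)) hy
    unfold EdgeOptimal at *
    rw [adjacentPairs_eq_restrictFace 0 0 f, supportSize_eq_restrictFace 0 0 f, h0, h1]
    -- A single support point with first coordinate 1 forces the whole face with first coordinate 0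
    -- into the support, so the sizes are 2^n and c ≤ 2^n.
    by_cases hx : ∃ x, restrictFace 0 (0 + 1) f x = 1
    · obtain ⟨x, hx⟩ := hx
      have full (y : Cube n) : restrictFace 0 0 f y = 1 :=
        hf _ _ ((toLex_insertNth_lt y x 0 1).2 (Or.inl (by decide))) hx
      have hsum : ∑ x, (restrictFace 0 0 f x : ℕ) * (restrictFace 0 (0 + 1) f x : ℕ) =
          supportSize (restrictFace 0 (0 + 1) f) := by
        simp [full, supportSize]
      have hle : supportSize (restrictFace 0 (0 + 1) f) ≤ 2 ^ n := by
        have := supportSize_boolCompl (restrictFace 0 (0 + 1) f)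
        omega
      rw [hsum, supportSize_eq_two_pow full, digitSumBelow_two_pow_add n _ hle]
      ring
    · have empty (x : Cube n) : restrictFace 0 (0 + 1) f x = 0 := by
        have := not_exists.1 hx x
        generalize restrictFace 0 (0 + 1) f x = a at *
        revert a; decide
      rw [supportSize_eq_zero.2 empty]
      simp only [empty]
      simp [digitSumBelow_zero]

theorem IsLexicographic.edgeOptimal {n : ℕ} {f : BoolFun n} (hf : IsLexicographic f) :
    EdgeOptimal f := by
  rcases hf with hf | hf
  · exact edgeOptimal_of_isLowerSet hf
  · have : IsLowerSet {x : Lex (Cube n) | boolCompl f (ofLex x) = 1} := by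
      convert hf.compl using 1
      ext x
      simp only [boolCompl, Set.mem_ofPred_eq, Set.mem_compl_iff]
      generalize f (ofLex x) = a
      revert a; decide
    have := (edgeOptimal_of_isLowerSet this).boolCompl
    rwa [boolCompl_boolCompl] at this

theorem exists_isLexicographic (n N : ℕ) (hN : N ≤ 2 ^ n) :
    ∃ f : BoolFun n, supportSize f = N ∧ IsLexicographic f := by
  have hc : Fintype.card (Lex (Cube n)) = 2 ^ n := by
    change Fintype.card (Cube n) = _
    simp
  let e := monoEquivOfFin (Lex (Cube n)) hc
  refine ⟨fun x => if (e.symm (toLex x) : ℕ) < N then 1 else 0, ?_, Or.inl ?_⟩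
  · unfold supportSize
    rw [← Equiv.sum_comp (e.toEquiv.trans ofLex)]
    have : ∀ i : Fin (2 ^ n), (((if (e.symm (toLex ((e.toEquiv.trans ofLex) i)) : ℕ) < N
        then 1 else 0 : Fin 2)) : ℕ) = if (i : ℕ) < N then 1 else 0 := fun i => by
      simp only [Equiv.trans_apply, toLex_ofLex]
      change (((if (e.symm (e i) : ℕ) < N then 1 else 0 : Fin 2)) : ℕ) = _
      rw [OrderIso.symm_apply_apply]
      split_ifs <;> rfl
    simp only [this, Fin.sum_univ_eq_sum_range (fun i => if i < N then 1 else 0), Finset.sum_boole]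
    have : (Finset.range (2 ^ n)).filter (· < N) = Finset.range N := by
      ext; simp; omega
    simp [this]
  · intro x y hxy hx
    have h1 : e.symm y ≤ e.symm x := e.symm.monotone hxy
    simp only [Set.mem_ofPred_eq, toLex_ofLex] at hx ⊢
    have : (e.symm x : ℕ) < N := by
      by_contra h
      simp [h] at hx
    exact if_pos (lt_of_le_of_lt (Fin.le_def.1 h1) this)

/-! ### Agreement through the noise operator -/

/-- The probability that the noise vector equals `z`. -/
def noiseWeight {n : ℕ} (ε : ℝ) (z : Cube n) : ℝ := ∏ i, if z i = 0 then 1 - ε else ε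

/-- The noise operator. -/
def noiseOp {n : ℕ} (ε : ℝ) (f : BoolFun n) (x : Cube n) : ℝ :=
  ∑ z, noiseWeight ε z * bitToReal (f (x + z))

/-- The agreement probability as a function of the noise rate. -/
noncomputable def agreement {n : ℕ} (k : ℕ) (ε : ℝ) (f : BoolFun n) : ℝ :=
  (∑ x, (noiseOp ε f x ^ k + (1 - noiseOp ε f x) ^ k)) / 2 ^ n

theorem sum_noiseWeight {n : ℕ} (ε : ℝ) : ∑ z : Cube n, noiseWeight ε z = 1 := by
  unfold noiseWeight
  rw [← Fintype.piFinset_univ,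
    ← Finset.prod_univ_sum (fun _ : Fin n => Finset.univ) (fun _ b => if b = 0 then 1 - ε else ε)]
  simp

theorem bernoulliBit_real_singleton {ε : ℝ} (h0 : 0 ≤ ε) (h1 : ε ≤ 1) (b : Fin 2) :
    (bernoulliBit ε).real {b} = if b = 0 then 1 - ε else ε := by
  fin_cases b <;> simp [bernoulliBit, Measure.real, h0, h1]

instance bernoulliBit_isFiniteMeasure (ε : ℝ) : IsFiniteMeasure (bernoulliBit ε) := by
  constructor
  simp [bernoulliBit]

instance cubeNoise_isFiniteMeasure (n : ℕ) (ε : ℝ) : IsFiniteMeasure (cubeNoise n ε) := by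
  unfold cubeNoise; infer_instance

theorem cubeNoise_real_singleton {n : ℕ} {ε : ℝ} (h0 : 0 ≤ ε) (h1 : ε ≤ 1) (z : Cube n) :
    (cubeNoise n ε).real {z} = noiseWeight ε z := by
  simp only [cubeNoise, Measure.real, Measure.pi_singleton, ENNReal.toReal_prod, noiseWeight]
  exact Finset.prod_congr rfl fun i _ => bernoulliBit_real_singleton h0 h1 (z i)

theorem cubeUniform_real_singleton {n : ℕ} (x : Cube n) :
    (cubeUniform n).real {x} = 1 / 2 ^ n := by
  simp [cubeUniform, Measure.real, ProbabilityTheory.uniformOn_univ]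

instance cubeUniform_isProbabilityMeasure (n : ℕ) : IsProbabilityMeasure (cubeUniform n) :=
  ProbabilityTheory.isProbabilityMeasure_uniformOn Set.finite_univ Set.univ_nonempty

/-- All bits agree when all are 1 or all are 0; these events are disjoint only because k ≥ 1. -/
theorem indicator_agree {k : ℕ} (hk : 1 ≤ k) (v : Fin k → Fin 2) [Decidable (∀ i j, v i = v j)] :
    (if ∀ i j, v i = v j then (1 : ℝ) else 0) =
      ∏ i, bitToReal (v i) + ∏ i, (1 - bitToReal (v i)) := by
  have hb : ∀ b : Fin 2, b = 0 ∨ b = 1 := by decide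
  have i0 : Fin k := ⟨0, hk⟩
  have hk0 : k ≠ 0 := by omega
  split_ifs with h
  · have : v = fun _ => v i0 := funext fun i => h i i0
    rw [this]
    rcases hb (v i0) with h | h <;> simp [h, bitToReal, hk0]
  · push Not at h
    obtain ⟨i, j, hij⟩ := h
    have : (∃ i, v i = 0) ∧ ∃ j, v j = 1 := by
      rcases hb (v i) with hi | hi <;> rcases hb (v j) with hj | hj
      · exact absurd (hi.trans hj.symm) hij
      · exact ⟨⟨i, hi⟩, j, hj⟩
      · exact ⟨⟨j, hj⟩, i, hi⟩
      · exact absurd (hi.trans hj.symm) hij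
    obtain ⟨⟨i, hi⟩, j, hj⟩ := this
    rw [Finset.prod_eq_zero (Finset.mem_univ i) (by simp [hi, bitToReal]),
      Finset.prod_eq_zero (Finset.mem_univ j) (by simp [hj, bitToReal]), add_zero]

theorem agreementProb_eq_agreement {n k : ℕ} (hk : 1 ≤ k) {ρ : ℝ} (h1 : ρ ≤ 1)
    (f : BoolFun n) : agreementProb k ρ f = agreement k ((1 - Real.sqrt ρ) / 2) f := by
  classical
  have hs0 := Real.sqrt_nonneg ρ
  have hs1 := Real.sqrt_le_one.2 h1
  set ε := (1 - Real.sqrt ρ) / 2 with hε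
  have hε0 : 0 ≤ ε := by rw [hε]; linarith
  have hε1 : ε ≤ 1 := by rw [hε]; linarith
  unfold agreementProb correlatedLaw
  rw [map_measureReal_apply (measurable_of_finite _) (Set.toFinite _).measurableSet, ← hε]
  set μ := (cubeUniform n).prod (Measure.pi fun _ : Fin k => cubeNoise n ε) with hμ
  have hsing (x : Cube n) (z : Fin k → Cube n) :
      μ.real {(x, z)} = 1 / 2 ^ n * ∏ j, noiseWeight ε (z j) := by
    rw [← Set.singleton_prod_singleton, hμ, measureReal_prod_prod, cubeUniform_real_singleton]
    congr 1
    simp only [Measure.real, Measure.pi_singleton, ENNReal.toReal_prod]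
    exact Finset.prod_congr rfl fun i _ => cubeNoise_real_singleton hε0 hε1 (z i)
  have hset : ((fun (ω : Cube n × (Fin k → Cube n)) (i : Fin k) => ω.1 + ω.2 i) ⁻¹'
      {y | ∀ i j : Fin k, f (y i) = f (y j)}) =
      (Finset.univ.filter fun ω : Cube n × (Fin k → Cube n) =>
        ∀ i j, f (ω.1 + ω.2 i) = f (ω.1 + ω.2 j) : Finset _) := by
    ext; simp
  have hone (x : Cube n) :
      1 - noiseOp ε f x = ∑ z, noiseWeight ε z * (1 - bitToReal (f (x + z))) := by
    simp only [mul_sub, mul_one, Finset.sum_sub_distrib, sum_noiseWeight, noiseOp]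
  rw [hset, ← sum_measureReal_singleton, Finset.sum_filter, Fintype.sum_prod_type, agreement,
    Finset.sum_div]
  refine Finset.sum_congr rfl fun x _ => ?_
  rw [hone, noiseOp, Fintype.sum_pow, Fintype.sum_pow, ← Finset.sum_add_distrib, Finset.sum_div]
  refine Finset.sum_congr rfl fun z _ => ?_
  rw [Finset.prod_mul_distrib, Finset.prod_mul_distrib, ← mul_add,
    ← indicator_agree hk fun i => f (x + z i)]
  dsimp only
  split_ifs
  · rw [hsing]; ring
  · simp

theorem sum_noiseOp {n : ℕ} (ε : ℝ) (f : BoolFun n) :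
    ∑ x, noiseOp ε f x = ∑ x, bitToReal (f x) := by
  unfold noiseOp
  rw [Finset.sum_comm]
  simp only [← Finset.mul_sum]
  have (z : Cube n) : ∑ x, bitToReal (f (x + z)) = ∑ x, bitToReal (f x) :=
    Equiv.sum_comp (Equiv.addRight z) fun x => bitToReal (f x)
  simp only [this, ← Finset.sum_mul, sum_noiseWeight, one_mul]

theorem noiseOp_eq_sum {n : ℕ} (ε : ℝ) (f : BoolFun n) (x : Cube n) :
    noiseOp ε f x = ∑ y, (∏ i, if x i = y i then 1 - ε else ε) * bitToReal (f y) := by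
  rw [noiseOp, ← (Equiv.subRight x).sum_comp]
  refine Finset.sum_congr rfl fun y _ => ?_
  have (i : Fin n) : y i - x i = 0 ↔ x i = y i := by rw [sub_eq_zero, eq_comm]
  simp [noiseWeight, this]

theorem noiseOp_eq_sum_hammingDist {n : ℕ} (ε : ℝ) (f : BoolFun n) (x : Cube n) :
    noiseOp ε f x =
      ∑ y, (1 - ε) ^ (n - hammingDist x y) * ε ^ hammingDist x y * bitToReal (f y) := by
  rw [noiseOp_eq_sum]
  refine Finset.sum_congr rfl fun y _ => ?_
  congr 1
  rw [Finset.prod_ite, Finset.prod_const, Finset.prod_const]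
  have h := Finset.card_filter_add_card_filter_not (s := Finset.univ) fun i => x i = y i
  rw [Finset.card_univ, Fintype.card_fin] at h
  have hd : hammingDist x y = (Finset.univ.filter fun i => ¬ x i = y i).card := rfl
  rw [hd, ← Nat.eq_sub_of_add_eq h]

/-- The noise kernel depends only on the Hamming distance. -/
theorem CubeEquivalent.agreement_eq {n : ℕ} {f g : BoolFun n} (h : CubeEquivalent f g) (k : ℕ)
    (ε : ℝ) : agreement k ε f = agreement k ε g := by
  obtain ⟨e, he, hfg⟩ := h
  unfold agreement
  rw [← e.sum_comp fun x => noiseOp ε g x ^ k + (1 - noiseOp ε g x) ^ k]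
  have (x : Cube n) : noiseOp ε g (e x) = noiseOp ε f x := by
    rw [noiseOp_eq_sum_hammingDist, noiseOp_eq_sum_hammingDist, ← e.sum_comp]
    simp only [he, hfg]
  simp only [this]

theorem sum_bitToReal {n : ℕ} (f : BoolFun n) : ∑ x, bitToReal (f x) = supportSize f := by
  simp [supportSize, bitToReal]

theorem boolMean_eq {n : ℕ} (f : BoolFun n) : boolMean f = supportSize f / 2 ^ n := by
  rw [boolMean, sum_bitToReal]

/-! ### First-order expansion at noise rate 0 -/

/-- The derivative of the noise operator at noise rate `0`. -/
theorem hasDerivAt_noiseOp_zero {n : ℕ} (f : BoolFun n) (x : Cube n) :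
    HasDerivAt (fun ε => noiseOp ε f x)
      ((∑ y, if hammingDist x y = 1 then bitToReal (f y) else 0) - n * bitToReal (f x)) 0 := by
  have key (y : Cube n) : HasDerivAt
      (fun ε : ℝ => (1 - ε) ^ (n - hammingDist x y) * ε ^ hammingDist x y * bitToReal (f y))
      ((if hammingDist x y = 1 then bitToReal (f y) else 0) -
        if x = y then n * bitToReal (f x) else 0) 0 := by
    have h1 : HasDerivAt (fun ε : ℝ => 1 - ε) (-1) 0 := by
      simpa using (hasDerivAt_id (0 : ℝ)).const_sub 1
    have h2 := ((h1.fun_pow (n - hammingDist x y)).fun_mul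
      ((hasDerivAt_id (0 : ℝ)).fun_pow (hammingDist x y))).mul_const (bitToReal (f y))
    refine h2.congr_deriv ?_
    -- At ε = 0 only distances 0 and 1 contribute to the derivative.
    by_cases hxy : x = y
    · subst hxy
      simp
    · have hd : hammingDist x y ≠ 0 := by simpa using hxy
      rw [if_neg hxy]
      rcases eq_or_ne (hammingDist x y) 1 with h | h
      · simp [h]
      · have : hammingDist x y - 1 ≠ 0 := by omega
        simp [hd, h, this]
  have := HasDerivAt.fun_sum fun y (_ : y ∈ Finset.univ) => key y
  rw [Finset.sum_sub_distrib, Finset.sum_ite_eq, if_pos (Finset.mem_univ _)] at this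
  simpa only [noiseOp_eq_sum_hammingDist] using this

theorem noiseOp_zero {n : ℕ} (f : BoolFun n) (x : Cube n) : noiseOp 0 f x = bitToReal (f x) := by
  have (y : Cube n) : (∏ i, if x i = y i then (1 : ℝ) - 0 else 0) = if x = y then 1 else 0 := by
    simp [Finset.prod_ite_zero, funext_iff]
  simp only [noiseOp_eq_sum, this]
  simp

theorem cast_adjacentPairs {n : ℕ} (f : BoolFun n) : (adjacentPairs f : ℝ) =
    ∑ x, bitToReal (f x) * ∑ y, if hammingDist x y = 1 then bitToReal (f y) else 0 := by
  simp [adjacentPairs, bitToReal, Finset.mul_sum]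

/-- The derivative of the agreement at noise rate `0` is governed by the edge boundary. -/
theorem hasDerivAt_agreement_zero {n k : ℕ} (hk : 2 ≤ k) (f : BoolFun n) :
    HasDerivAt (fun ε => agreement k ε f)
      (2 * k * (adjacentPairs f - n * supportSize f) / 2 ^ n) 0 := by
  have hk1 : k - 1 ≠ 0 := by omega
  set D : Cube n → ℝ := fun x =>
    (∑ y, if hammingDist x y = 1 then bitToReal (f y) else 0) - n * bitToReal (f x) with hD
  have hsum : ∑ x, D x = 0 := by
    have h1 := HasDerivAt.fun_sum fun x (_ : x ∈ Finset.univ) => hasDerivAt_noiseOp_zero f x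
    simp only [sum_noiseOp] at h1
    exact h1.unique (hasDerivAt_const _ _)
  -- At p ∈ {0,1}, the derivative k(p^(k-1) - (1-p)^(k-1)) equals k(2p - 1), because k ≥ 2.
  have h (x : Cube n) : HasDerivAt
      (fun ε => noiseOp ε f x ^ k + (1 - noiseOp ε f x) ^ k)
      (k * (2 * bitToReal (f x) - 1) * D x) 0 := by
    have h1 : HasDerivAt (fun ε => noiseOp ε f x) (D x) 0 := hasDerivAt_noiseOp_zero f x
    have h2 := (h1.fun_pow k).fun_add ((h1.const_sub 1).fun_pow k)
    refine h2.congr_deriv ?_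
    rw [noiseOp_zero]
    have hb : ∀ b : Fin 2, b = 0 ∨ b = 1 := by decide
    rcases hb (f x) with hb | hb
    · simp [hb, bitToReal, hk1]
    · simp [hb, bitToReal, hk1, -mul_eq_mul_right_iff]
      ring
  have h3 := (HasDerivAt.fun_sum fun x (_ : x ∈ Finset.univ) => h x).div_const (2 ^ n)
  refine h3.congr_deriv ?_
  congr 1
  have h4 (x : Cube n) : k * (2 * bitToReal (f x) - 1) * D x =
      2 * k * (bitToReal (f x) * ∑ y, if hammingDist x y = 1 then bitToReal (f y) else 0) -
        2 * k * n * bitToReal (f x) - k * D x := by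
    have hb : ∀ b : Fin 2, b = 0 ∨ b = 1 := by decide
    rcases hb (f x) with hb | hb
    · simp [hD, hb, bitToReal]
    · simp [hD, hb, bitToReal]
      ring
  simp only [h4, Finset.sum_sub_distrib, ← Finset.mul_sum, hsum, ← cast_adjacentPairs,
    sum_bitToReal]
  ring

theorem agreement_zero {n k : ℕ} (hk : 1 ≤ k) (f : BoolFun n) : agreement k 0 f = 1 := by
  have hk0 : k ≠ 0 := by omega
  have hb : ∀ b : Fin 2, b = 0 ∨ b = 1 := by decide
  have (x : Cube n) : bitToReal (f x) ^ k + (1 - bitToReal (f x)) ^ k = 1 := by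
    rcases hb (f x) with h | h <;> simp [h, bitToReal, hk0]
  simp [agreement, noiseOp_zero, this]

open Filter Topology in
/-- For small noise rate, fewer boundary edges mean higher agreement. -/
theorem eventually_agreement_lt {n k : ℕ} (hk : 2 ≤ k) {f g : BoolFun n}
    (hsize : supportSize f = supportSize g) (h : adjacentPairs g < adjacentPairs f) :
    ∀ᶠ ε in 𝓝[>] (0 : ℝ), agreement k ε g < agreement k ε f := by
  have hd := (hasDerivAt_agreement_zero hk f).sub (hasDerivAt_agreement_zero hk g)
  have hpos : (0 : ℝ) < 2 * k * (adjacentPairs f - n * supportSize f) / 2 ^ n -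
      2 * k * (adjacentPairs g - n * supportSize g) / 2 ^ n := by
    rw [← sub_div, hsize]
    have : (adjacentPairs g : ℝ) < adjacentPairs f := by exact_mod_cast h
    have hk' : (0 : ℝ) < k := by exact_mod_cast (by omega : 0 < k)
    refine div_pos ?_ (by positivity)
    nlinarith
  have ht := (hasDerivAt_iff_tendsto_slope.1 hd).mono_left
    (nhdsWithin_mono 0 fun x (hx : 0 < x) => hx.ne')
  filter_upwards [ht.eventually (lt_mem_nhds hpos), self_mem_nhdsWithin] with ε hε hε0
  simp only [slope_def_field, Pi.sub_apply, agreement_zero (by omega : 1 ≤ k), sub_self,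
    sub_zero] at hε
  have := (div_pos_iff_of_pos_right hε0).1 hε
  linarith

open Filter Topology in
/-- For small noise rate, optimal sets maximize the agreement. -/
theorem EdgeOptimal.eventually_agreement_le {n k : ℕ} (hk : 2 ≤ k) {f : BoolFun n}
    (hf : EdgeOptimal f) (g : BoolFun n) (hsize : supportSize f = supportSize g) :
    ∀ᶠ ε in 𝓝[>] (0 : ℝ), agreement k ε g ≤ agreement k ε f := by
  rcases (adjacentPairs_le g).lt_or_eq with h | h
  · rw [← hsize, ← hf] at h
    exact (eventually_agreement_lt hk hsize h).mono fun _ => le_of_lt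
  -- With equality g is optimal as well, hence isometric to f, and the agreements coincide for every
  -- ε.
  · exact Eventually.of_forall fun ε => ((hf.cubeEquivalent h hsize).agreement_eq k ε).ge

/-! ### Second-order expansion at correlation 0 -/

section

open Filter Topology

/-- The degree-one part of the Walsh expansion. -/
noncomputable def degreeOnePart {n : ℕ} (f : BoolFun n) (x : Cube n) : ℝ :=
  ∑ i, fourierCoeff01 f {i} * walsh {i} x

theorem walsh_singleton {n : ℕ} (i : Fin n) (x : Cube n) : walsh {i} x = (-1) ^ (x i : ℕ) := by
  simp [walsh]

theorem walsh_singleton_mul {n : ℕ} (i : Fin n) (x y : Cube n) :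
    walsh {i} x * walsh {i} y = if x i = y i then 1 else -1 := by
  have : ∀ b : Fin 2, b = 0 ∨ b = 1 := by decide
  rcases this (x i) with h | h <;> rcases this (y i) with h' | h' <;>
    simp [walsh_singleton, h, h']

theorem sum_walsh_singleton_mul {n : ℕ} (i j : Fin n) :
    ∑ x : Cube n, walsh {i} x * walsh {j} x = if i = j then 2 ^ n else 0 := by
  split_ifs with hij
  · subst hij
    simp [walsh_singleton_mul]
  · have hflip (b : Fin 2) : (-1 : ℝ) ^ ((b + 1 : Fin 2) : ℕ) = -(-1) ^ (b : ℕ) := by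
      fin_cases b <;> simp
    have h := Equiv.sum_comp (Equiv.addRight (Pi.single i 1 : Cube n))
      fun x => walsh {i} x * walsh {j} x
    have h' (x : Cube n) : walsh {i} (x + (Pi.single i 1 : Cube n)) *
        walsh {j} (x + (Pi.single i 1 : Cube n)) = -(walsh {i} x * walsh {j} x) := by
      simp [walsh_singleton, hflip, Pi.single_eq_of_ne (Ne.symm hij)]
    simp only [Equiv.coe_addRight, h', Finset.sum_neg_distrib] at h
    linarith

theorem sum_degreeOnePart_sq {n : ℕ} (f : BoolFun n) :
    ∑ x, degreeOnePart f x ^ 2 = 2 ^ n * degreeOneWeight f := by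
  have h (x : Cube n) : degreeOnePart f x ^ 2 = ∑ i, ∑ j,
      fourierCoeff01 f {i} * fourierCoeff01 f {j} * (walsh {i} x * walsh {j} x) := by
    rw [sq, degreeOnePart, Finset.sum_mul_sum]
    exact Finset.sum_congr rfl fun i _ => Finset.sum_congr rfl fun j _ => by ring
  simp only [h]
  rw [Finset.sum_comm, degreeOneWeight, Finset.mul_sum]
  refine Finset.sum_congr rfl fun i _ => ?_
  rw [Finset.sum_comm]
  simp only [← Finset.mul_sum, sum_walsh_singleton_mul]
  simp
  ring

/-- In the variable δ = 1 - 2ε the kernel factors so that the power of δ records the Walsh degree.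
-/
theorem noiseOp_half_sub {n : ℕ} (δ : ℝ) (f : BoolFun n) (x : Cube n) :
    noiseOp ((1 - δ) / 2) f x =
      ∑ y, (∏ i, (1 + δ * (walsh {i} x * walsh {i} y))) * (bitToReal (f y) / 2 ^ n) := by
  rw [noiseOp_eq_sum]
  refine Finset.sum_congr rfl fun y _ => ?_
  have h (i : Fin n) : (if x i = y i then 1 - (1 - δ) / 2 else (1 - δ) / 2) =
      (1 + δ * (walsh {i} x * walsh {i} y)) / 2 := by
    rw [walsh_singleton_mul]; split_ifs <;> ring
  simp only [h, Finset.prod_div_distrib, Finset.prod_const, Finset.card_univ, Fintype.card_fin]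
  ring

theorem noiseOp_half {n : ℕ} (f : BoolFun n) (x : Cube n) :
    noiseOp ((1 - 0) / 2) f x = boolMean f := by
  rw [noiseOp_half_sub]
  simp [boolMean, Finset.sum_div]

theorem hasDerivAt_noiseOp_half {n : ℕ} (f : BoolFun n) (x : Cube n) :
    HasDerivAt (fun δ => noiseOp ((1 - δ) / 2) f x) (degreeOnePart f x) 0 := by
  have h1 (y : Cube n) (i : Fin n) : HasDerivAt
      (fun δ : ℝ => 1 + δ * (walsh {i} x * walsh {i} y)) (walsh {i} x * walsh {i} y) 0 := by
    simpa using ((hasDerivAt_id (0 : ℝ)).mul_const (walsh {i} x * walsh {i} y)).const_add 1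
  have h2 (y : Cube n) := (HasDerivAt.fun_finsetProd fun i (_ : i ∈ Finset.univ) => h1 y i).mul_const
    (bitToReal (f y) / 2 ^ n)
  have h3 := HasDerivAt.fun_sum fun y (_ : y ∈ Finset.univ) => h2 y
  simp only [← noiseOp_half_sub] at h3
  refine h3.congr_deriv ?_
  simp only [zero_mul, add_zero, Finset.prod_const_one, one_smul, degreeOnePart, fourierCoeff01,
    Finset.sum_mul, Finset.sum_div]
  rw [Finset.sum_comm]
  exact Finset.sum_congr rfl fun i _ => Finset.sum_congr rfl fun y _ => by ring

/-- Taylor expansion with a continuous remainder, built by multiplying by m + h. Truncated exponents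
are harmless: their coefficients vanish. -/
theorem exists_add_pow_eq (m : ℝ) (k : ℕ) : ∃ q : ℝ → ℝ, Continuous q ∧
    q 0 = k.choose 2 * m ^ (k - 2) ∧
    ∀ h, (m + h) ^ k = m ^ k + k * m ^ (k - 1) * h + h ^ 2 * q h := by
  induction k with
  | zero => exact ⟨fun _ => 0, continuous_const, by simp, by simp⟩
  | succ k ih =>
    obtain ⟨q, hq, hq0, hqh⟩ := ih
    refine ⟨fun h => k * m ^ (k - 1) + (m + h) * q h, by fun_prop, ?_, fun h => ?_⟩
    · rcases k with _ | _ | k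
      · simp [hq0]
      · simp [hq0]
      · beta_reduce
        rw [hq0, Nat.choose_succ_succ' (k + 1 + 1) 1]
        simp
        ring
    · rw [pow_succ, hqh]
      rcases k with _ | k
      · simp; ring
      · simp
        ring

/-- Second-order expansion of the agreement at correlation `0`. -/
theorem tendsto_agreement_sub_div {n : ℕ} (k : ℕ) (f : BoolFun n) :
    Tendsto (fun δ => (agreement k ((1 - δ) / 2) f -
        (boolMean f ^ k + (1 - boolMean f) ^ k)) / δ ^ 2) (𝓝[>] 0)
      (𝓝 (k.choose 2 * (boolMean f ^ (k - 2) + (1 - boolMean f) ^ (k - 2)) *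
        degreeOneWeight f)) := by
  set m := boolMean f with hm
  obtain ⟨q, hq, hq0, hqh⟩ := exists_add_pow_eq m k
  obtain ⟨r, hr, hr0, hrh⟩ := exists_add_pow_eq (1 - m) k
  set d : ℝ → Cube n → ℝ := fun δ x => noiseOp ((1 - δ) / 2) f x - m with hd
  have hdsum (δ : ℝ) : ∑ x, d δ x = 0 := by
    simp only [hd, Finset.sum_sub_distrib, sum_noiseOp, hm, boolMean]
    simp only [Finset.sum_const, Finset.card_univ, Fintype.card_pi, Fintype.card_fin,
      Finset.prod_const, nsmul_eq_mul]
    push_cast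
    field_simp
    ring
  -- The term linear in `d δ x` disappears on summation over x by `hdsum`.
  have hterm (δ : ℝ) (x : Cube n) :
      noiseOp ((1 - δ) / 2) f x ^ k + (1 - noiseOp ((1 - δ) / 2) f x) ^ k =
        (m ^ k + (1 - m) ^ k) + (k * m ^ (k - 1) - k * (1 - m) ^ (k - 1)) * d δ x +
          d δ x ^ 2 * (q (d δ x) + r (-d δ x)) := by
    have h1 : noiseOp ((1 - δ) / 2) f x = m + d δ x := by simp [hd]
    have h2 : 1 - (m + d δ x) = (1 - m) + -d δ x := by ring
    rw [h1, h2, hqh, hrh]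
    ring
  have hagree (δ : ℝ) : (agreement k ((1 - δ) / 2) f - (m ^ k + (1 - m) ^ k)) / δ ^ 2 =
      (∑ x, (d δ x / δ) ^ 2 * (q (d δ x) + r (-d δ x))) / 2 ^ n := by
    simp only [agreement, hterm, Finset.sum_add_distrib, ← Finset.mul_sum, hdsum, div_pow,
      div_mul_eq_mul_div, ← Finset.sum_div]
    simp only [Finset.sum_const, Finset.card_univ, Fintype.card_pi, Fintype.card_fin,
      Finset.prod_const, nsmul_eq_mul]
    push_cast
    field_simp
    ring
  have hd1 (x : Cube n) : Tendsto (fun δ => d δ x / δ) (𝓝[>] 0) (𝓝 (degreeOnePart f x)) := by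
    have := (hasDerivAt_iff_tendsto_slope.1 (hasDerivAt_noiseOp_half f x)).mono_left
      (nhdsWithin_mono 0 fun x (hx : 0 < x) => hx.ne')
    refine this.congr fun δ => ?_
    rw [slope_def_field, noiseOp_half, sub_zero]
  have hd0 (x : Cube n) : Tendsto (fun δ => d δ x) (𝓝[>] 0) (𝓝 0) := by
    have := ((hasDerivAt_noiseOp_half f x).continuousAt.tendsto.sub_const m).mono_left
      (nhdsWithin_le_nhds (s := Set.Ioi 0))
    simpa only [noiseOp_half, ← hm, sub_self] using this
  simp only [hagree]
  have hlim : Tendsto (fun δ => (∑ x, (d δ x / δ) ^ 2 * (q (d δ x) + r (-d δ x))) / 2 ^ n)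
      (𝓝[>] 0) (𝓝 ((∑ x, degreeOnePart f x ^ 2 * (q 0 + r (-0))) / 2 ^ n)) :=
    (tendsto_finsetSum _ fun x _ => ((hd1 x).pow 2).mul
      (((hq.tendsto 0).comp (hd0 x)).add ((hr.tendsto _).comp (hd0 x).neg))).div_const _
  convert hlim using 2
  rw [← Finset.sum_mul, sum_degreeOnePart_sq, neg_zero, hq0, hr0]
  field_simp

theorem boolMean_mem_Icc {n : ℕ} (f : BoolFun n) : boolMean f ∈ Set.Icc (0 : ℝ) 1 := by
  rw [boolMean_eq]
  have h := supportSize_boolCompl f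
  have h' : (supportSize f : ℝ) ≤ 2 ^ n := by
    exact_mod_cast (by omega : supportSize f ≤ 2 ^ n)
  exact ⟨by positivity, (div_le_one (by positivity)).2 h'⟩

/-- For small correlation, larger degree-one weight means higher agreement. -/
theorem eventually_agreement_lt_of_degreeOneWeight {n k : ℕ} (hk : 2 ≤ k) {f g : BoolFun n}
    (hmean : boolMean f = boolMean g) (h : degreeOneWeight g < degreeOneWeight f) :
    ∀ᶠ δ in 𝓝[>] (0 : ℝ), agreement k ((1 - δ) / 2) g < agreement k ((1 - δ) / 2) f := by
  have hf := tendsto_agreement_sub_div k f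
  have hg := tendsto_agreement_sub_div k g
  rw [← hmean] at hg
  obtain ⟨h0, h1⟩ := boolMean_mem_Icc f
  have hc : 0 < (k.choose 2 : ℝ) := by exact_mod_cast Nat.choose_pos hk
  have hpos : 0 < boolMean f ^ (k - 2) + (1 - boolMean f) ^ (k - 2) := by
    rcases h0.lt_or_eq with h | h
    · have : 0 ≤ (1 - boolMean f) ^ (k - 2) := pow_nonneg (by linarith) _
      positivity
    · rw [← h]; simp; positivity
  have hlt := mul_lt_mul_of_pos_left h (mul_pos hc hpos)
  filter_upwards [hg.eventually_lt hf hlt, self_mem_nhdsWithin] with δ hδ (hδ0 : 0 < δ)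
  have := (div_lt_div_iff_of_pos_right (by positivity)).1 hδ
  linarith

/-! ### Eventual comparison of agreements -/

theorem exists_polynomial_agreement {n : ℕ} (k : ℕ) (f : BoolFun n) :
    ∃ P : Polynomial ℝ, ∀ δ, P.eval δ = agreement k ((1 - δ) / 2) f := by
  let T : Cube n → Polynomial ℝ := fun x => ∑ y,
    (∏ i, (1 + Polynomial.X * Polynomial.C (walsh {i} x * walsh {i} y))) *
      Polynomial.C (bitToReal (f y) / 2 ^ n)
  have hT (δ : ℝ) (x : Cube n) : (T x).eval δ = noiseOp ((1 - δ) / 2) f x := by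
    simp only [T, noiseOp_half_sub, Polynomial.eval_finsetSum, Polynomial.eval_mul,
      Polynomial.eval_prod, Polynomial.eval_add, Polynomial.eval_one, Polynomial.eval_X,
      Polynomial.eval_C]
  refine ⟨(∑ x, (T x ^ k + (1 - T x) ^ k)) * Polynomial.C (1 / 2 ^ n), fun δ => ?_⟩
  simp only [agreement, ← hT, Polynomial.eval_finsetSum, Polynomial.eval_mul,
    Polynomial.eval_add, Polynomial.eval_pow, Polynomial.eval_sub, Polynomial.eval_one,
    Polynomial.eval_C]
  ring

/-- After the full power of X is removed, the remaining factor is nonzero at 0 and fixes the sign on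
the right. -/
theorem eventually_eval_nonneg_or_nonpos (P : Polynomial ℝ) :
    (∀ᶠ x in 𝓝[>] (0 : ℝ), 0 ≤ P.eval x) ∨ ∀ᶠ x in 𝓝[>] (0 : ℝ), P.eval x ≤ 0 := by
  rcases eq_or_ne P 0 with rfl | hP
  · simp
  obtain ⟨Q, hQ, hQ0⟩ := Polynomial.exists_eq_pow_rootMultiplicity_mul_and_not_dvd P hP 0
  rw [Polynomial.dvd_iff_isRoot, Polynomial.IsRoot.def] at hQ0
  have hcont : Tendsto (fun x => Q.eval x) (𝓝[>] 0) (𝓝 (Q.eval 0)) :=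
    (Q.continuous.tendsto 0).mono_left nhdsWithin_le_nhds
  rw [hQ]
  simp only [map_zero, sub_zero, Polynomial.eval_mul, Polynomial.eval_pow, Polynomial.eval_X]
  rcases lt_or_gt_of_ne hQ0 with h | h
  · right
    filter_upwards [hcont.eventually_lt_const h, self_mem_nhdsWithin] with x hx (hx0 : 0 < x)
    exact mul_nonpos_of_nonneg_of_nonpos (by positivity) hx.le
  · left
    filter_upwards [hcont.eventually_const_lt h, self_mem_nhdsWithin] with x hx (hx0 : 0 < x)
    positivity

theorem eventually_agreement_le_total {n : ℕ} (k : ℕ) (f g : BoolFun n) :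
    (∀ᶠ δ in 𝓝[>] (0 : ℝ), agreement k ((1 - δ) / 2) f ≤ agreement k ((1 - δ) / 2) g) ∨
      ∀ᶠ δ in 𝓝[>] (0 : ℝ), agreement k ((1 - δ) / 2) g ≤ agreement k ((1 - δ) / 2) f := by
  obtain ⟨P, hP⟩ := exists_polynomial_agreement k f
  obtain ⟨Q, hQ⟩ := exists_polynomial_agreement k g
  have := eventually_eval_nonneg_or_nonpos (Q - P)
  simpa only [Polynomial.eval_sub, hP, hQ, sub_nonneg, sub_nonpos] using this

/-! ### Uniform thresholds -/

theorem tendsto_sqrt_nhdsGT_zero : Tendsto Real.sqrt (𝓝[>] 0) (𝓝[>] 0) := by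
  refine tendsto_nhdsWithin_iff.2 ⟨?_, ?_⟩
  · simpa using (Real.continuous_sqrt.tendsto 0).mono_left (nhdsWithin_le_nhds (s := Set.Ioi 0))
  · filter_upwards [self_mem_nhdsWithin] with x hx
    exact Real.sqrt_pos.2 hx

theorem tendsto_noiseRate_nhdsLT_one :
    Tendsto (fun ρ => (1 - Real.sqrt ρ) / 2) (𝓝[<] 1) (𝓝[>] 0) := by
  refine tendsto_nhdsWithin_iff.2 ⟨?_, ?_⟩
  · have : Continuous fun ρ => (1 - Real.sqrt ρ) / 2 := by fun_prop
    simpa using (this.tendsto 1).mono_left (nhdsWithin_le_nhds (s := Set.Iio 1))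
  · filter_upwards [self_mem_nhdsWithin] with x (hx : x < 1)
    have : Real.sqrt x < 1 := by rw [Real.sqrt_lt' one_pos]; simpa using hx
    simpa using this

theorem exists_Ioo_of_eventually_nhdsGT_zero {p : ℝ → Prop} (h : ∀ᶠ x in 𝓝[>] (0 : ℝ), p x) :
    ∃ a ∈ Set.Ioo (0 : ℝ) 1, ∀ x ∈ Set.Ioo 0 a, p x := by
  obtain ⟨u, hu, hsub⟩ := mem_nhdsGT_iff_exists_Ioo_subset.1 h
  exact ⟨min u (1 / 2), ⟨lt_min hu (by norm_num), (min_le_right _ _).trans_lt (by norm_num)⟩,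
    fun x hx => hsub ⟨hx.1, hx.2.trans_le (min_le_left _ _)⟩⟩

theorem exists_Ioo_of_eventually_nhdsLT_one {p : ℝ → Prop} (h : ∀ᶠ x in 𝓝[<] (1 : ℝ), p x) :
    ∃ a ∈ Set.Ioo (0 : ℝ) 1, ∀ x ∈ Set.Ioo a 1, p x := by
  obtain ⟨u, hu, hsub⟩ := mem_nhdsLT_iff_exists_Ioo_subset.1 h
  exact ⟨max u (1 / 2), ⟨lt_max_of_lt_right (by norm_num), max_lt hu (by norm_num)⟩,
    fun x hx => hsub ⟨(le_max_left _ _).trans_lt hx.1, hx.2⟩⟩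

/-- Finitely many functions of which any two are eventually comparable have an eventual
maximum. -/
theorem Set.Finite.exists_eventually_max {α β : Type*} {s : Set α} (hs : s.Finite)
    (hne : s.Nonempty) {l : Filter β} {F : α → β → ℝ}
    (htot : ∀ a b, (∀ᶠ x in l, F a x ≤ F b x) ∨ ∀ᶠ x in l, F b x ≤ F a x) :
    ∃ a ∈ s, ∀ b ∈ s, ∀ᶠ x in l, F b x ≤ F a x := by
  induction s, hs using Set.Finite.induction_on with
  | empty => simp at hne
  | @insert a s _ _ ih =>
    rcases s.eq_empty_or_nonempty with rfl | hs
    · exact ⟨a, by simp, fun b hb => by simp_all⟩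
    obtain ⟨c, hc, hmax⟩ := ih hs
    rcases htot a c with h | h
    · refine ⟨c, Or.inr hc, fun b hb => ?_⟩
      rcases hb with rfl | hb
      exacts [h, hmax b hb]
    · refine ⟨a, Or.inl rfl, fun b hb => ?_⟩
      rcases hb with rfl | hb
      · exact Eventually.of_forall fun _ => le_rfl
      · filter_upwards [h, hmax b hb] with x h1 h2 using h2.trans h1

theorem exists_smallCorrelation_threshold (n k : ℕ) (hk : 2 ≤ k) :
    ∃ ρ₀ ∈ Set.Ioo (0 : ℝ) 1, ∀ m : ℝ, (boolFunWithMean n m).Nonempty →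
      (∃ f ∈ boolFunWithMean n m,
        IsMaxOn degreeOneWeight (boolFunWithMean n m) f ∧
        ∀ ρ ∈ Set.Ioo 0 ρ₀, IsMaxOn (agreementProb k ρ) (boolFunWithMean n m) f) ∧
      (∀ ρ ∈ Set.Ioo 0 ρ₀, ∀ f ∈ boolFunWithMean n m,
        IsMaxOn (agreementProb k ρ) (boolFunWithMean n m) f →
          IsMaxOn degreeOneWeight (boolFunWithMean n m) f) ∧
      (∀ ρ ∈ Set.Ioo 0 ρ₀, ∀ f ∈ boolFunWithMean n m, ∀ g ∈ boolFunWithMean n m,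
        degreeOneWeight g < degreeOneWeight f → agreementProb k ρ g < agreementProb k ρ f) := by
  set F : BoolFun n → ℝ → ℝ := fun f δ => agreement k ((1 - δ) / 2) f with hF
  -- Finiteness of the set of pairs turns every eventual comparison into one valid below a common
  -- threshold, chosen before m.
  have hall : ∀ᶠ δ in 𝓝[>] (0 : ℝ), ∀ f g : BoolFun n,
      ((∀ᶠ δ in 𝓝[>] (0 : ℝ), F g δ ≤ F f δ) → F g δ ≤ F f δ) ∧
      (boolMean f = boolMean g → degreeOneWeight g < degreeOneWeight f → F g δ < F f δ) := by
    refine eventually_all.2 fun f => eventually_all.2 fun g => Eventually.and ?_ ?_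
    · by_cases h : ∀ᶠ δ in 𝓝[>] (0 : ℝ), F g δ ≤ F f δ
      · exact h.mono fun _ hx _ => hx
      · exact Eventually.of_forall fun _ hx => absurd hx h
    · by_cases h : boolMean f = boolMean g ∧ degreeOneWeight g < degreeOneWeight f
      · exact (eventually_agreement_lt_of_degreeOneWeight hk h.1 h.2).mono fun _ hx _ _ => hx
      · exact Eventually.of_forall fun _ h1 h2 => absurd ⟨h1, h2⟩ h
  obtain ⟨ρ₀, hρ₀, hsmall⟩ :=
    exists_Ioo_of_eventually_nhdsGT_zero (tendsto_sqrt_nhdsGT_zero.eventually hall)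
  have hA (ρ : ℝ) (hρ : ρ ∈ Set.Ioo 0 ρ₀) (f : BoolFun n) :
      agreementProb k ρ f = F f (Real.sqrt ρ) :=
    agreementProb_eq_agreement (by omega) (hρ.2.trans hρ₀.2).le f
  have hlt : ∀ m : ℝ, ∀ ρ ∈ Set.Ioo 0 ρ₀, ∀ f ∈ boolFunWithMean n m, ∀ g ∈ boolFunWithMean n m,
      degreeOneWeight g < degreeOneWeight f → agreementProb k ρ g < agreementProb k ρ f := by
    intro m ρ hρ f hf g hg h
    rw [hA ρ hρ, hA ρ hρ]
    exact (hsmall ρ hρ f g).2 (hf.trans hg.symm) h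
  have hmax : ∀ m : ℝ, ∀ ρ ∈ Set.Ioo 0 ρ₀, ∀ f ∈ boolFunWithMean n m,
      IsMaxOn (agreementProb k ρ) (boolFunWithMean n m) f →
        IsMaxOn degreeOneWeight (boolFunWithMean n m) f := fun m ρ hρ f hf h g hg =>
    not_lt.1 fun hfg => (hlt m ρ hρ g hg f hf hfg).not_ge (h hg)
  refine ⟨ρ₀, hρ₀, fun m hne => ⟨?_, hmax m, hlt m⟩⟩
  obtain ⟨f, hf, hfmax⟩ := (Set.toFinite (boolFunWithMean n m)).exists_eventually_max hne
    (l := 𝓝[>] (0 : ℝ)) (F := F) (eventually_agreement_le_total k)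
  have hfA : ∀ ρ ∈ Set.Ioo 0 ρ₀, IsMaxOn (agreementProb k ρ) (boolFunWithMean n m) f := by
    intro ρ hρ g hg
    change agreementProb k ρ g ≤ agreementProb k ρ f
    rw [hA ρ hρ, hA ρ hρ]
    exact (hsmall ρ hρ f g).1 (hfmax g hg)
  -- Maximality at a single ρ already gives maximal degree-one weight.
  have hmid : ρ₀ / 2 ∈ Set.Ioo 0 ρ₀ := ⟨half_pos hρ₀.1, half_lt_self hρ₀.1⟩
  exact ⟨f, hf, hmax m _ hmid f hf (hfA _ hmid), hfA⟩

theorem exists_largeCorrelation_threshold (n k : ℕ) (hk : 2 ≤ k) :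
    ∃ ρ₁ ∈ Set.Ioo (0 : ℝ) 1, ∀ m : ℝ, (boolFunWithMean n m).Nonempty →
      (∃ f ∈ boolFunWithMean n m, IsLexicographic f) ∧
      ∀ ρ ∈ Set.Ioo ρ₁ 1, ∀ f ∈ boolFunWithMean n m, IsLexicographic f →
        IsMaxOn (agreementProb k ρ) (boolFunWithMean n m) f := by
  have hall : ∀ᶠ ε in 𝓝[>] (0 : ℝ), ∀ f g : BoolFun n, EdgeOptimal f →
      supportSize f = supportSize g → agreement k ε g ≤ agreement k ε f := by
    refine eventually_all.2 fun f => eventually_all.2 fun g => ?_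
    by_cases h : EdgeOptimal f ∧ supportSize f = supportSize g
    · exact (h.1.eventually_agreement_le hk g h.2).mono fun _ hx _ _ => hx
    · exact Eventually.of_forall fun _ h1 h2 => absurd ⟨h1, h2⟩ h
  obtain ⟨ρ₁, hρ₁, hlarge⟩ :=
    exists_Ioo_of_eventually_nhdsLT_one (tendsto_noiseRate_nhdsLT_one.eventually hall)
  refine ⟨ρ₁, hρ₁, fun m ⟨g, hg⟩ => ⟨?_, fun ρ hρ f hf hlex g hg => ?_⟩⟩
  · obtain ⟨f, hf, hlex⟩ := exists_isLexicographic n (supportSize g)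
      (by have := supportSize_boolCompl g; omega)
    refine ⟨f, ?_, hlex⟩
    change boolMean f = m
    rw [boolMean_eq, hf, ← boolMean_eq, hg]
  · have hsize : supportSize f = supportSize g := by
      have h : boolMean f = boolMean g := Eq.trans hf (Eq.symm hg)
      rw [boolMean_eq, boolMean_eq, div_left_inj' (by positivity)] at h
      exact_mod_cast h
    change agreementProb k ρ g ≤ agreementProb k ρ f
    rw [agreementProb_eq_agreement (by omega) hρ.2.le, agreementProb_eq_agreement (by omega) hρ.2.le]
    exact hlarge ρ hρ f g hlex.edgeOptimal hsize

end

theorem mainTheorem5 (n k : ℕ) (hk : 2 ≤ k) :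
    (∃ ρ₀ ∈ Set.Ioo (0 : ℝ) 1, ∀ m : ℝ, (boolFunWithMean n m).Nonempty →
      (∃ f ∈ boolFunWithMean n m,
        IsMaxOn degreeOneWeight (boolFunWithMean n m) f ∧
        ∀ ρ ∈ Set.Ioo 0 ρ₀, IsMaxOn (agreementProb k ρ) (boolFunWithMean n m) f) ∧
      (∀ ρ ∈ Set.Ioo 0 ρ₀, ∀ f ∈ boolFunWithMean n m,
        IsMaxOn (agreementProb k ρ) (boolFunWithMean n m) f →
          IsMaxOn degreeOneWeight (boolFunWithMean n m) f) ∧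
      (∀ ρ ∈ Set.Ioo 0 ρ₀, ∀ f ∈ boolFunWithMean n m, ∀ g ∈ boolFunWithMean n m,
        degreeOneWeight g < degreeOneWeight f → agreementProb k ρ g < agreementProb k ρ f)) ∧
    (∃ ρ₁ ∈ Set.Ioo (0 : ℝ) 1, ∀ m : ℝ, (boolFunWithMean n m).Nonempty →
      (∃ f ∈ boolFunWithMean n m, IsLexicographic f) ∧
      ∀ ρ ∈ Set.Ioo ρ₁ 1, ∀ f ∈ boolFunWithMean n m, IsLexicographic f →
        IsMaxOn (agreementProb k ρ) (boolFunWithMean n m) f) :=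
  ⟨exists_smallCorrelation_threshold n k hk, exists_largeCorrelation_threshold n k hk⟩
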